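/- Let $r,\sigma,K,T$ be real constants. An exercise policy for the American put with strike $K$ and maturity $T$ is given by its boundary, a continuous function $b:[0,T]\to[0,K]$. A solution of the extended Black–Scholes problem for $b$ is a bounded continuous function $V(x,t)$ on $x\ge 0$, $0\le t\le T$ whose derivatives $V_t,V_x,V_{xx}$ exist, are continuous, and satisfy $$rV=V_t+rxV_x+\tfrac12\sigma^2x^2V_{xx}\qquad (x>0,\ 0<t<T),$$ and such that $V(b(t),t)=K-b(t)$ and $\lim_{x\to\infty}V(x,t)=0$ for all $t\in[0,T]$, and $V(x,T)=0$ for all $x\ge b(T)$. (The last condition and the first one at $t=T$ force $b(T)=K$.) The replication value of the policy is $U(x,t)=V(x,t)$ for $x>b(t)$ and $U(x,t)=[K-x]^+$ for $x\le b(t)$. Let $\pi$ be a policy with boundary $b$, and assume that the extended problem for $b$ has a solution $V^\pi$. Let $q$ be a policy with boundary $\gamma$ such that $V^\pi(\gamma(t),t)\le[K-\gamma(t)]^+$ for all $t\in[0,T]$, and assume that the extended problem for $\gamma$ has a solution $V^q$. Then: (i) $V^\pi(x,t)\le V^q(x,t)$ for all $t\in[0,T]$ and $x\ge\gamma(t)$.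 (ii) For a proper selection of $\gamma$, $U^\pi(x,t)\le U^q(x,t)$ for all $x\ge0$, $t\in[0,T]$. Here a selection of $\gamma$ is proper if (a) for every $t\in[0,T]$, $V^\pi(x,t)\le[K-x]^+$ for all $x$ between $b(t)$ and $\gamma(t)$ (endpoints included), and (b) whenever $\gamma(t)<b(t)$ for some $t\in[0,T]$, then for every $s\in(0,T)$ with $s\ge t$ the right derivative of $x\mapsto V^q(x,s)$ at $x=\gamma(s)$ exists and is at least $-1$ (this holds in particular under smooth pasting, $V^q_x(\gamma(s),s)=-1$). Moreover, the boundary can always be selected according to the slope of $V^\pi$: there is a continuous $\gamma:[0,T]\to[0,K]$ with $\gamma(T)=K$ such that, at every $t\in(0,T)$ with $b(t)>0$, $\gamma(t)>b(t)$ if $V^\pi_x(b(t),t)<-1$, $\gamma(t)<b(t)$ if $V^\pi_x(b(t),t)>-1$, and $\gamma(t)=b(t)$ if $V^\pi_x(b(t),t)=-1$; and, for every $t\in[0,T]$, $V^\pi(x,t)<[K-x]^+$ for all $x\ne b(t)$ between $b(t)$ and $\gamma(t)$ (with $\gamma(t)$ included). -/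

import Mathlib

open Set Filter Topology

/-- The partial derivative `∂V/∂x` of a function `V(x,t)` of price and time. -/
noncomputable def partialX (V : ℝ → ℝ → ℝ) (x t : ℝ) : ℝ := deriv (fun y => V y t) x

/-- The partial derivative `∂V/∂t`. -/
noncomputable def partialT (V : ℝ → ℝ → ℝ) (x t : ℝ) : ℝ := deriv (fun s => V x s) t

/-- The second partial derivative `∂²V/∂x²`. -/
noncomputable def partialXX (V : ℝ → ℝ → ℝ) (x t : ℝ) : ℝ := partialX (partialX V) x t

/-- The payoff `[K - x]⁺` of the put. -/
noncomputable def payoff (K x : ℝ) : ℝ := max (K - x) 0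

/-- The boundary `b` of an exercise policy: a continuous function on `[0,T]` with values in
`[0,K]`. The policy exercises at the first time at which the price is at most `b(t)`. -/
structure IsExerciseBoundary (K T : ℝ) (b : ℝ → ℝ) : Prop where
  continuousOn : ContinuousOn b (Icc 0 T)
  nonneg : ∀ t ∈ Icc 0 T, 0 ≤ b t
  le_strike : ∀ t ∈ Icc 0 T, b t ≤ K

/-- `V` is a (classical, bounded) solution of the Black–Scholes equation
`r V = V_t + r x V_x + (1/2) σ² x² V_xx` on all of `x ≥ 0`, `0 ≤ t ≤ T`: it is continuous and
bounded there, and in the interior `x > 0`, `0 < t < T` the derivatives `V_t, V_x, V_xx` exist, are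
continuous and satisfy the equation. -/
structure IsBlackScholesSolution (r σ T : ℝ) (V : ℝ → ℝ → ℝ) : Prop where
  continuousOn : ContinuousOn (fun p : ℝ × ℝ => V p.1 p.2) (Ici 0 ×ˢ Icc 0 T)
  bounded : ∃ M : ℝ, ∀ x, 0 ≤ x → ∀ t ∈ Icc 0 T, |V x t| ≤ M
  differentiable_t : ∀ x, 0 < x → ∀ t ∈ Ioo 0 T, DifferentiableAt ℝ (fun s => V x s) t
  differentiable_x : ∀ x, 0 < x → ∀ t ∈ Ioo 0 T, DifferentiableAt ℝ (fun y => V y t) x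
  differentiable_xx : ∀ x, 0 < x → ∀ t ∈ Ioo 0 T,
    DifferentiableAt ℝ (fun y => partialX V y t) x
  continuousOn_t : ContinuousOn (fun p : ℝ × ℝ => partialT V p.1 p.2) (Ioi 0 ×ˢ Ioo 0 T)
  continuousOn_x : ContinuousOn (fun p : ℝ × ℝ => partialX V p.1 p.2) (Ioi 0 ×ˢ Ioo 0 T)
  continuousOn_xx : ContinuousOn (fun p : ℝ × ℝ => partialXX V p.1 p.2) (Ioi 0 ×ˢ Ioo 0 T)
  equation : ∀ x, 0 < x → ∀ t ∈ Ioo 0 T,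
    r * V x t = partialT V x t + r * x * partialX V x t
      + 1 / 2 * σ ^ 2 * x ^ 2 * partialXX V x t

/-- `V` solves the extended Black–Scholes problem for the exercise boundary `b`: it solves the
Black–Scholes equation for all `x ≥ 0`, `0 ≤ t ≤ T` (below the boundary as well as above it), with
`V(b(t),t) = K - b(t)`, `V(∞,t) = 0`, and `V(x,T) = 0` for `x ≥ b(T)`. -/
structure IsExtendedSolution (r σ K T : ℝ) (b : ℝ → ℝ) (V : ℝ → ℝ → ℝ) : Prop where
  solution : IsBlackScholesSolution r σ T V
  boundary : ∀ t ∈ Icc 0 T, V (b t) t = K - b t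
  infinity : ∀ t ∈ Icc 0 T, Tendsto (fun x => V x t) atTop (𝓝 0)
  terminal : ∀ x, b T ≤ x → V x T = 0

/-- The replication value `U(x,t)` of the policy with boundary `b`, where `V` is its continuation
value: `V(x,t)` in the continuation region `x > b(t)`, and `[K - x]⁺` for `x ≤ b(t)`. -/
noncomputable def replicationValue (K : ℝ) (b : ℝ → ℝ) (V : ℝ → ℝ → ℝ) (x t : ℝ) : ℝ :=
  if b t < x then V x t else payoff K x

/-- Between the old boundary `b` and the new boundary `γ`, immediate exercise is at least as good
as continuing with the old policy, whose (extended) continuation value is `V`. -/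
def ExerciseBetterBetween (K T : ℝ) (b γ : ℝ → ℝ) (V : ℝ → ℝ → ℝ) : Prop :=
  ∀ t ∈ Icc 0 T, ∀ x ∈ uIcc (b t) (γ t), V x t ≤ payoff K x

/-- Whenever the boundary is lowered at a time `t`, i.e. `γ(t) < b(t)`, the slope of the new
continuation value `W` at the new boundary, taken from the continuation side, is at least `-1` from
time `t` on. This holds in particular under smooth pasting, where the slope is `-1`. -/
def SlopeConditionWhereLowered (T : ℝ) (b γ : ℝ → ℝ) (W : ℝ → ℝ → ℝ) : Prop :=
  ∀ t ∈ Icc 0 T, γ t < b t → ∀ s ∈ Ioo 0 T, t ≤ s →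
    ∃ d : ℝ, -1 ≤ d ∧ HasDerivWithinAt (fun x => W x s) d (Ici (γ s)) (γ s)

/-- The rule for choosing the new boundary: wherever the slope `V_x(b(t),t)` of the old value is
less than `-1` the boundary is raised, wherever it is greater than `-1` the boundary is lowered, and
wherever it equals `-1` (smooth pasting) the boundary is kept; and between the two boundaries
immediate exercise is strictly better than continuing with the old policy. -/
structure IsImprovingSelection (K T : ℝ) (b γ : ℝ → ℝ) (V : ℝ → ℝ → ℝ) : Prop where
  raise : ∀ t ∈ Ioo 0 T, 0 < b t → partialX V (b t) t < -1 → b t < γ t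
  lower : ∀ t ∈ Ioo 0 T, 0 < b t → -1 < partialX V (b t) t → γ t < b t
  keep : ∀ t ∈ Ioo 0 T, 0 < b t → partialX V (b t) t = -1 → γ t = b t
  better : ∀ t ∈ Icc 0 T, ∀ x ∈ uIcc (b t) (γ t), x ≠ b t → V x t < payoff K x

/-! Everything above a boundary rests on one maximum principle. Scaling prices by `l` turns the
terms `x V_x` and `x² V_xx` into derivatives at `l = 1`, and linear functions of price solve the
equation, so linear penalties cost nothing. Time runs backward from `T`: the weight `(t - τ)
e^{-rt}` vanishes at `τ`, so no data are needed there (`no_interior_max`).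

For (i), it is applied to the difference of two solutions (`le_of_boundary`). For (ii), the only
further difficulty is a price `γ(t) < x ≤ b(t)`, where the new policy waits and must be worth at
least `K - x`. This follows if `V^q` falls no faster than `x` rises. A bound on `V_x` would call for
differentiating the equation; instead the principle is applied to pairs of prices `x ≤ y`
(`sub_le_of_slope_of_mem_Ioo`).

For the selection, the sign of `V_x + 1` at `b(t)` decides on which side `V(x,t) + x` drops below
`K`. The room available is locally uniform, and an inf-convolution makes the displacement continuous
(`exists_continuous_size_selection`). -/

theorem IsLocalMax.deriv_deriv_nonpos {f : ℝ → ℝ} {x : ℝ} (h : IsLocalMax f x)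
    (hc : ContinuousAt f x) : deriv (deriv f) x ≤ 0 := by
  by_contra! hpos
  -- A point that is both a local maximum and a local minimum has a neighbourhood where `f` is
  -- constant.
  have hmin := isLocalMin_of_deriv_deriv_pos hpos h.deriv_eq_zero hc
  have hev : f =ᶠ[𝓝 x] fun _ => f x := by
    filter_upwards [h, hmin] with y h1 h2 using le_antisymm h1 h2
  have h2 : deriv (deriv f) x = 0 := by
    rw [hev.deriv.deriv_eq]
    simp
  linarith

/-! ### Maximum principle at a point -/

namespace IsBlackScholesSolution

variable {r σ T : ℝ} {V V₁ V₂ : ℝ → ℝ → ℝ}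

theorem zero (r σ T : ℝ) : IsBlackScholesSolution r σ T (fun _ _ => 0) := by
  have hx : partialX (fun _ _ => 0) = fun _ _ => 0 := by ext; simp [partialX]
  have ht : partialT (fun _ _ => 0) = fun _ _ => 0 := by ext; simp [partialT]
  have hxx : partialXX (fun _ _ => 0) = fun _ _ => 0 := by ext; simp [partialXX, hx]
  constructor <;> simp [hx, ht, hxx, continuousOn_const]
  exact ⟨0, fun _ _ _ _ _ => le_rfl⟩

/-- The function `λ ↦ V(λa, t)` is differentiable at every `λ` with `λ a > 0`. -/
theorem hasDerivAt_scale (h : IsBlackScholesSolution r σ T V) {a t l : ℝ} (ha : 0 < l * a)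
    (ht : t ∈ Ioo 0 T) :
    HasDerivAt (fun l => V (l * a) t) (partialX V (l * a) t * a) l := by
  have h1 : HasDerivAt (fun y => V y t) (partialX V (l * a) t) (l * a) :=
    (h.differentiable_x _ ha t ht).hasDerivAt
  have h2 : HasDerivAt (fun l : ℝ => l * a) a l := by simpa using (hasDerivAt_id l).mul_const a
  exact h1.comp l h2

theorem hasDerivAt_partialX_scale (h : IsBlackScholesSolution r σ T V) {a t : ℝ} (ha : 0 < a)
    (ht : t ∈ Ioo 0 T) :
    HasDerivAt (fun l => partialX V (l * a) t * a) (a ^ 2 * partialXX V a t) 1 := by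
  have h1 : HasDerivAt (fun y => partialX V y t) (partialXX V a t) (1 * a) := by
    rw [one_mul]
    exact (h.differentiable_xx _ ha t ht).hasDerivAt
  have h2 : HasDerivAt (fun l : ℝ => l * a) a 1 := by simpa using (hasDerivAt_id 1).mul_const a
  have h3 : HasDerivAt (fun l => partialX V (l * a) t * a) (partialXX V a t * a * a) 1 :=
    (h1.comp 1 h2).mul_const a
  rwa [show a ^ 2 * partialXX V a t = partialXX V a t * a * a by ring]

/-- The pointwise step of the maximum principle. The difference `V₁(a,t) - V₂(b,t) - c`, in which
`a`, `b`, `c` scale together, weighted by `(t - τ) e^{-rt}`, has no positive interior maximum. -/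
theorem no_interior_max (h₁ : IsBlackScholesSolution r σ T V₁)
    (h₂ : IsBlackScholesSolution r σ T V₂) {a b c t τ : ℝ} (ha : 0 < a) (hb : 0 < b)
    (ht : t ∈ Ioo 0 T) (hτ : τ < t) (hpos : 0 < V₁ a t - V₂ b t - c)
    (hx : IsLocalMax (fun l => V₁ (l * a) t - V₂ (l * b) t - l * c) 1)
    (hs : IsLocalMax (fun s => (s - τ) * Real.exp (-r * s) * (V₁ a s - V₂ b s - c)) t) :
    False := by
  have hf : ∀ᶠ l in 𝓝 (1 : ℝ), HasDerivAt (fun l => V₁ (l * a) t - V₂ (l * b) t - l * c)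
      (partialX V₁ (l * a) t * a - partialX V₂ (l * b) t * b - c) l := by
    filter_upwards [lt_mem_nhds (show (0 : ℝ) < 1 by norm_num)] with l hl
    have h3 : HasDerivAt (fun l : ℝ => l * c) c l := by simpa using (hasDerivAt_id l).mul_const c
    exact ((h₁.hasDerivAt_scale (mul_pos hl ha) ht).sub
      (h₂.hasDerivAt_scale (mul_pos hl hb) ht)).sub h3
  have hfirst := hx.hasDerivAt_eq_zero hf.self_of_nhds
  have hsecond : a ^ 2 * partialXX V₁ a t - b ^ 2 * partialXX V₂ b t ≤ 0 := by
    have hev : deriv (fun l => V₁ (l * a) t - V₂ (l * b) t - l * c) =ᶠ[𝓝 1]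
        fun l => partialX V₁ (l * a) t * a - partialX V₂ (l * b) t * b - c :=
      hf.mono fun l hl => hl.deriv
    have := hx.deriv_deriv_nonpos hf.self_of_nhds.continuousAt
    have hd : HasDerivAt (fun l => partialX V₁ (l * a) t * a - partialX V₂ (l * b) t * b - c)
        (a ^ 2 * partialXX V₁ a t - b ^ 2 * partialXX V₂ b t) 1 :=
      ((h₁.hasDerivAt_partialX_scale ha ht).sub (h₂.hasDerivAt_partialX_scale hb ht)).sub_const c
    rwa [hev.deriv_eq, hd.deriv] at this
  have hexp : HasDerivAt (fun s => Real.exp (-r * s)) (Real.exp (-r * t) * (-r)) t := by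
    have : HasDerivAt (fun s : ℝ => -r * s) (-r) t := by simpa using (hasDerivAt_id t).const_mul (-r)
    exact this.exp
  have hV : HasDerivAt (fun s => V₁ a s - V₂ b s - c) (partialT V₁ a t - partialT V₂ b t) t :=
    ((h₁.differentiable_t a ha t ht).hasDerivAt.sub
      (h₂.differentiable_t b hb t ht).hasDerivAt).sub_const c
  have htime := hs.hasDerivAt_eq_zero ((((hasDerivAt_id t).sub_const τ).mul hexp).mul hV)
  have e₁ := h₁.equation a ha t ht
  have e₂ := h₂.equation b hb t ht
  simp only [one_mul, id, Pi.mul_apply] at hfirst htime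
  set W := V₁ a t - V₂ b t - c with hW
  -- By `hfirst` the drift terms of the two equations differ by exactly `r * c`, which turns `r (V₁
  -- - V₂)` into `r W`; only the second-order term is left.
  have hWt : 0 ≤ partialT V₁ a t - partialT V₂ b t - r * W := by
    have : partialT V₁ a t - partialT V₂ b t - r * W
        = -(1 / 2 * σ ^ 2 * (a ^ 2 * partialXX V₁ a t - b ^ 2 * partialXX V₂ b t)) := by
      rw [hW]; linear_combination e₂ - e₁ - r * hfirst
    rw [this, neg_nonneg]
    exact mul_nonpos_of_nonneg_of_nonpos (by positivity) hsecond
  have hE := Real.exp_pos (-r * t)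
  have hsum : Real.exp (-r * t) *
      (W + (t - τ) * (partialT V₁ a t - partialT V₂ b t - r * W)) = 0 := by
    linear_combination htime
  have : 0 < W + (t - τ) * (partialT V₁ a t - partialT V₂ b t - r * W) :=
    add_pos_of_pos_of_nonneg hpos (mul_nonneg (sub_nonneg.2 hτ.le) hWt)
  exact (mul_pos hE this).ne' hsum

theorem continuousOn_time (h : IsBlackScholesSolution r σ T V) {x : ℝ} (hx : 0 ≤ x) :
    ContinuousOn (fun t => V x t) (Icc 0 T) :=
  h.continuousOn.comp (f := fun t => (x, t)) (by fun_prop) fun _ ht => ⟨hx, ht⟩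

/-- Lower bounds strictly above a boundary pass to the initial time of a half-open interval. -/
theorem le_of_forall_later (h₁ : IsBlackScholesSolution r σ T V₁)
    (h₂ : IsBlackScholesSolution r σ T V₂) {γ : ℝ → ℝ} (hγ : ContinuousOn γ (Icc 0 T))
    {τ x c : ℝ} (hτ : τ ∈ Ico 0 T) (hx : γ τ < x) (hx0 : 0 ≤ x)
    (h : ∀ t ∈ Ioo τ T, γ t ≤ x → V₁ x t - V₂ x t ≤ c) : V₁ x τ - V₂ x τ ≤ c := by
  have hsub : Ioo τ T ⊆ Icc 0 T := fun t ht => ⟨hτ.1.trans ht.1.le, ht.2.le⟩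
  have hmem : τ ∈ Icc 0 T := ⟨hτ.1, hτ.2.le⟩
  have hc : Tendsto (fun t => V₁ x t - V₂ x t) (𝓝[Ioo τ T] τ) (𝓝 (V₁ x τ - V₂ x τ)) :=
    (((h₁.continuousOn_time hx0).sub (h₂.continuousOn_time hx0)) τ hmem).mono_left
      (nhdsWithin_mono _ hsub)
  have hγ' : ∀ᶠ t in 𝓝[Ioo τ T] τ, γ t < x :=
    ((hγ τ hmem).mono_left (nhdsWithin_mono _ hsub)).eventually (gt_mem_nhds hx)
  have : (𝓝[Ioo τ T] τ).NeBot := left_nhdsWithin_Ioo_neBot hτ.2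
  refine le_of_tendsto hc ?_
  filter_upwards [hγ', self_mem_nhdsWithin] with t h1 h2 using h t h2 h1.le

end IsBlackScholesSolution

/-! ### Comparison above a boundary -/

namespace IsBlackScholesSolution

variable {r σ T : ℝ} {V V₁ V₂ : ℝ → ℝ → ℝ}

/-- Comparison of two bounded solutions above a boundary, at interior times. -/
theorem sub_nonpos_of_boundary_of_mem_Ioo (h₁ : IsBlackScholesSolution r σ T V₁)
    (h₂ : IsBlackScholesSolution r σ T V₂) {γ : ℝ → ℝ} (hγ : ContinuousOn γ (Icc 0 T))
    (hγ0 : ∀ t ∈ Icc 0 T, 0 ≤ γ t) (hbd : ∀ t ∈ Icc 0 T, V₁ (γ t) t - V₂ (γ t) t ≤ 0)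
    (hT : ∀ x, γ T ≤ x → V₁ x T - V₂ x T ≤ 0) {t₀ x₀ : ℝ} (ht₀ : t₀ ∈ Ioo 0 T)
    (hx₀ : γ t₀ ≤ x₀) : V₁ x₀ t₀ - V₂ x₀ t₀ ≤ 0 := by
  by_contra! hpos
  obtain ⟨M₁, hM₁⟩ := h₁.bounded
  obtain ⟨M₂, hM₂⟩ := h₂.bounded
  have ht₀' : t₀ ∈ Icc 0 T := Ioo_subset_Icc_self ht₀
  have hx₀0 : 0 ≤ x₀ := (hγ0 t₀ ht₀').trans hx₀
  obtain ⟨ε, hε, hεx⟩ : ∃ ε > 0, 0 < V₁ x₀ t₀ - V₂ x₀ t₀ - ε * x₀ := by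
    refine ⟨(V₁ x₀ t₀ - V₂ x₀ t₀) / (2 * (x₀ + 1)), by positivity, ?_⟩
    have : (V₁ x₀ t₀ - V₂ x₀ t₀) / (2 * (x₀ + 1)) * x₀ < V₁ x₀ t₀ - V₂ x₀ t₀ := by
      rw [div_mul_eq_mul_div, div_lt_iff₀ (by positivity)]
      nlinarith
    linarith
  -- The solutions are bounded, so the penalty `ε * x` confines positive values to a compact set of
  -- prices; no limit at infinity is used.
  have hlarge : ∀ x, 0 ≤ x → ∀ t ∈ Icc 0 T, 0 < V₁ x t - V₂ x t - ε * x →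
      x < (M₁ + M₂) / ε := by
    intro x hx t ht h
    rw [lt_div_iff₀ hε]
    have := abs_le.1 (hM₁ x hx t ht)
    have := abs_le.1 (hM₂ x hx t ht)
    linarith
  set R := (M₁ + M₂) / ε
  set A : Set (ℝ × ℝ) := Icc 0 R ×ˢ Icc 0 T with hA
  set S : Set (ℝ × ℝ) := A ∩ (fun p => p.1 - γ p.2) ⁻¹' Ici 0 with hS
  have hAc : IsCompact A := isCompact_Icc.prod isCompact_Icc
  have hSc : IsCompact S := by
    refine hAc.of_isClosed_subset ?_ inter_subset_left
    refine ContinuousOn.preimage_isClosed_of_isClosed ?_ hAc.isClosed isClosed_Ici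
    exact continuousOn_fst.sub (hγ.comp continuousOn_snd fun p hp => hp.2)
  have hS₀ : (x₀, t₀) ∈ S :=
    ⟨⟨⟨hx₀0, (hlarge x₀ hx₀0 t₀ ht₀' hεx).le⟩, ht₀'⟩, sub_nonneg.2 hx₀⟩
  set F : ℝ × ℝ → ℝ := fun p =>
    (p.2 - 0) * Real.exp (-r * p.2) * (V₁ p.1 p.2 - V₂ p.1 p.2 - ε * p.1) with hF
  have hFc : ContinuousOn F S := by
    have hsub : S ⊆ Ici 0 ×ˢ Icc 0 T := fun p hp => ⟨hp.1.1.1, hp.1.2⟩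
    have c₁ := h₁.continuousOn.mono hsub
    have c₂ := h₂.continuousOn.mono hsub
    exact ContinuousOn.mul (by fun_prop) ((c₁.sub c₂).sub (by fun_prop))
  obtain ⟨⟨x, t⟩, ⟨⟨hxR, ht⟩, hxγ⟩, hmax⟩ := hSc.exists_isMaxOn ⟨_, hS₀⟩ hFc
  have hxγ : γ t ≤ x := sub_nonneg.1 hxγ
  have hFpos : 0 < F (x, t) :=
    lt_of_lt_of_le (mul_pos (mul_pos (sub_pos.2 ht₀.1) (Real.exp_pos _)) hεx) (hmax hS₀)
  have hx0 : 0 ≤ x := hxR.1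
  have htpos : 0 < t := by
    refine lt_of_le_of_ne ht.1 fun h => ?_
    simp [hF, ← h] at hFpos
  have hW : 0 < V₁ x t - V₂ x t - ε * x :=
    (mul_pos_iff_of_pos_left (mul_pos (sub_pos.2 htpos) (Real.exp_pos _))).1 hFpos
  have hεx' : 0 ≤ ε * x := mul_nonneg hε.le hx0
  have hxγ' : γ t < x := by
    refine lt_of_le_of_ne hxγ fun h => ?_
    have := hbd t ht
    rw [h] at this
    linarith
  have htT : t < T := by
    refine lt_of_le_of_ne ht.2 fun h => ?_
    subst h
    linarith [hT x hxγ]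
  have hxpos : 0 < x := (hγ0 t ht).trans_lt hxγ'
  have hxR' : x < R := hlarge x hx0 t ht hW
  refine h₁.no_interior_max h₂ (c := ε * x) hxpos hxpos ⟨htpos, htT⟩ htpos hW ?_ ?_
  · have hcont : Tendsto (fun l : ℝ => l * x) (𝓝 1) (𝓝 x) := by
      have : Continuous fun l : ℝ => l * x := by fun_prop
      simpa using this.tendsto 1
    filter_upwards [hcont.eventually (Ioo_mem_nhds hxγ' hxR')] with l hl
    have hm : F (l * x, t) ≤ F (x, t) :=
      hmax (show (l * x, t) ∈ S from
        ⟨⟨⟨(hγ0 t ht).trans hl.1.le, hl.2.le⟩, ht⟩, sub_nonneg.2 hl.1.le⟩)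
    have := le_of_mul_le_mul_left hm (mul_pos (sub_pos.2 htpos) (Real.exp_pos _))
    simp only [one_mul] at this ⊢
    linarith
  · have hγt := (hγ.continuousAt (Icc_mem_nhds htpos htT)).eventually (gt_mem_nhds hxγ')
    filter_upwards [hγt, Ioo_mem_nhds htpos htT] with s hs hs'
    exact hmax (show (x, s) ∈ S from ⟨⟨hxR, hs'.1.le, hs'.2.le⟩, sub_nonneg.2 hs.le⟩)

/-- Comparison of two bounded solutions above a boundary. -/
theorem le_of_boundary (h₁ : IsBlackScholesSolution r σ T V₁)
    (h₂ : IsBlackScholesSolution r σ T V₂) {γ : ℝ → ℝ} (hγ : ContinuousOn γ (Icc 0 T))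
    (hγ0 : ∀ t ∈ Icc 0 T, 0 ≤ γ t) (hbd : ∀ t ∈ Icc 0 T, V₁ (γ t) t ≤ V₂ (γ t) t)
    (hT : ∀ x, γ T ≤ x → V₁ x T ≤ V₂ x T) {t x : ℝ} (ht : t ∈ Icc 0 T)
    (hx : γ t ≤ x) : V₁ x t ≤ V₂ x t := by
  have key : ∀ t ∈ Ioo 0 T, ∀ x, γ t ≤ x → V₁ x t - V₂ x t ≤ 0 := fun t ht x hx =>
    h₁.sub_nonpos_of_boundary_of_mem_Ioo h₂ hγ hγ0 (fun t ht => sub_nonpos.2 (hbd t ht))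
      (fun x hx => sub_nonpos.2 (hT x hx)) ht hx
  rcases hx.eq_or_lt with rfl | hx'
  · exact hbd t ht
  rcases ht.2.eq_or_lt with rfl | htT
  · exact hT x hx
  exact sub_nonpos.1 (h₁.le_of_forall_later h₂ hγ ⟨ht.1, htT⟩ hx' ((hγ0 t ht).trans hx)
    fun s hs hs' => key s ⟨ht.1.trans_lt hs.1, hs.2⟩ x hs')

/-- If the slope at a boundary is at least `-1` from time `τ` on, then the solution has slope at
least `-1` along chords from the boundary. The proof is a maximum principle for pairs of prices. -/
theorem sub_le_of_slope_of_mem_Ioo (h : IsBlackScholesSolution r σ T V) {γ : ℝ → ℝ}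
    (hγ : ContinuousOn γ (Icc 0 T)) (hγ0 : ∀ t ∈ Icc 0 T, 0 ≤ γ t)
    (hT : ∀ x, γ T ≤ x → V x T = 0) {τ : ℝ} (hτ : 0 ≤ τ)
    (hslope : ∀ s ∈ Ioo τ T, ∃ d : ℝ, -1 ≤ d ∧
      HasDerivWithinAt (fun x => V x s) d (Ici (γ s)) (γ s))
    {t₀ y₀ : ℝ} (ht₀ : t₀ ∈ Ioo τ T) (hy₀ : γ t₀ ≤ y₀) :
    V (γ t₀) t₀ - V y₀ t₀ ≤ y₀ - γ t₀ := by
  by_contra! hpos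
  obtain ⟨M, hM⟩ := h.bounded
  set x₀ := γ t₀ with hx₀
  have ht₀' : t₀ ∈ Icc τ T := Ioo_subset_Icc_self ht₀
  have hsubI : Icc τ T ⊆ Icc 0 T := Icc_subset_Icc_left hτ
  have hx₀0 : 0 ≤ x₀ := hγ0 t₀ (hsubI ht₀')
  have hy₀0 : 0 ≤ y₀ := hx₀0.trans hy₀
  -- The penalty equals `(y - x) + ε (y - x) + ε y`. The first `ε` term gives a strict inequality at
  -- `x = γ(t)`; the second bounds `y` and handles `x = y`.
  obtain ⟨ε, hε, hεx⟩ : ∃ ε > 0,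
      0 < V x₀ t₀ - V y₀ t₀ - ((1 + 2 * ε) * y₀ - (1 + ε) * x₀) := by
    have hG : 0 < V x₀ t₀ - V y₀ t₀ - (y₀ - x₀) := by linarith
    refine ⟨(V x₀ t₀ - V y₀ t₀ - (y₀ - x₀)) / (4 * (y₀ + 1)), by positivity, ?_⟩
    have : (V x₀ t₀ - V y₀ t₀ - (y₀ - x₀)) / (4 * (y₀ + 1)) * (2 * y₀ - x₀)
        < V x₀ t₀ - V y₀ t₀ - (y₀ - x₀) := by
      rw [div_mul_eq_mul_div, div_lt_iff₀ (by positivity)]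
      exact mul_lt_mul_of_pos_left (by linarith) hG
    linarith
  have hlarge : ∀ x y, 0 ≤ x → x ≤ y → ∀ t ∈ Icc 0 T,
      0 < V x t - V y t - ((1 + 2 * ε) * y - (1 + ε) * x) → y < 2 * M / ε := by
    intro x y hx hxy t ht h
    rw [lt_div_iff₀ hε]
    have := abs_le.1 (hM x hx t ht)
    have := abs_le.1 (hM y (hx.trans hxy) t ht)
    have := mul_nonneg hε.le (sub_nonneg.2 hxy)
    linarith
  set R := 2 * M / ε
  set A : Set (ℝ × ℝ × ℝ) := Icc 0 R ×ˢ Icc 0 R ×ˢ Icc τ T with hA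
  set S₁ : Set (ℝ × ℝ × ℝ) := A ∩ (fun p => p.1 - γ p.2.2) ⁻¹' Ici 0 with hS₁
  set S : Set (ℝ × ℝ × ℝ) := S₁ ∩ {p | p.1 ≤ p.2.1} with hS
  have hAc : IsCompact A := isCompact_Icc.prod (isCompact_Icc.prod isCompact_Icc)
  have hSc : IsCompact S := by
    refine hAc.of_isClosed_subset (IsClosed.inter ?_ ?_)
      (inter_subset_left.trans inter_subset_left)
    · refine ContinuousOn.preimage_isClosed_of_isClosed ?_ hAc.isClosed isClosed_Ici
      exact continuousOn_fst.sub
        (hγ.comp (f := fun p : ℝ × ℝ × ℝ => p.2.2) (by fun_prop) fun p hp => hsubI hp.2.2)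
    · exact isClosed_le (by fun_prop) (by fun_prop)
  have hmemS : ∀ x y t, t ∈ Icc τ T → γ t ≤ x → x ≤ y → y ≤ R → (x, y, t) ∈ S :=
    fun x y t ht hx hxy hy =>
      have hx0 : 0 ≤ x := (hγ0 t (hsubI ht)).trans hx
      ⟨⟨⟨⟨hx0, hxy.trans hy⟩, ⟨hx0.trans hxy, hy⟩, ht⟩, sub_nonneg.2 hx⟩, hxy⟩
  have hS₀ : (x₀, y₀, t₀) ∈ S :=
    hmemS _ _ _ ht₀' le_rfl hy₀ (hlarge x₀ y₀ hx₀0 hy₀ t₀ (hsubI ht₀') hεx).le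
  set F : ℝ × ℝ × ℝ → ℝ := fun p => (p.2.2 - τ) * Real.exp (-r * p.2.2) *
    (V p.1 p.2.2 - V p.2.1 p.2.2 - ((1 + 2 * ε) * p.2.1 - (1 + ε) * p.1)) with hF
  have hFc : ContinuousOn F S := by
    have c₁ : ContinuousOn (fun p : ℝ × ℝ × ℝ => V p.1 p.2.2) S :=
      h.continuousOn.comp (f := fun p : ℝ × ℝ × ℝ => (p.1, p.2.2)) (by fun_prop)
        fun p hp => ⟨hp.1.1.1.1, hsubI hp.1.1.2.2⟩
    have c₂ : ContinuousOn (fun p : ℝ × ℝ × ℝ => V p.2.1 p.2.2) S :=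
      h.continuousOn.comp (f := fun p : ℝ × ℝ × ℝ => (p.2.1, p.2.2)) (by fun_prop)
        fun p hp => ⟨hp.1.1.2.1.1, hsubI hp.1.1.2.2⟩
    exact ContinuousOn.mul (by fun_prop) ((c₁.sub c₂).sub (by fun_prop))
  obtain ⟨⟨x, y, t⟩, ⟨⟨⟨hxR, hyR, ht⟩, hxγ⟩, hxy⟩, hmax⟩ := hSc.exists_isMaxOn ⟨_, hS₀⟩ hFc
  have hxγ : γ t ≤ x := sub_nonneg.1 hxγ
  have hxy : x ≤ y := hxy
  have hFpos : 0 < F (x, y, t) :=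
    lt_of_lt_of_le (mul_pos (mul_pos (sub_pos.2 ht₀.1) (Real.exp_pos _)) hεx) (hmax hS₀)
  have hx0 : 0 ≤ x := hxR.1
  have htτ : τ < t := by
    refine lt_of_le_of_ne ht.1 fun h => ?_
    simp [hF, ← h] at hFpos
  have hweight := mul_pos (sub_pos.2 htτ) (Real.exp_pos (-r * t))
  have hW : 0 < V x t - V y t - ((1 + 2 * ε) * y - (1 + ε) * x) :=
    (mul_pos_iff_of_pos_left hweight).1 hFpos
  have hxy' : x < y := by
    refine lt_of_le_of_ne hxy fun h => ?_
    subst h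
    have := mul_nonneg hε.le hx0
    linarith
  have htT : t < T := by
    refine lt_of_le_of_ne ht.2 fun h => ?_
    subst h
    rw [hT x hxγ, hT y (hxγ.trans hxy)] at hW
    have := mul_nonneg hε.le (sub_nonneg.2 hxy)
    have := mul_nonneg hε.le (hx0.trans hxy)
    linarith
  have hyR' : y < R := hlarge x y hx0 hxy t (hsubI ht) hW
  have hcmp : ∀ x' y', γ t ≤ x' → x' ≤ y' → y' ≤ R →
      V x' t - V y' t - ((1 + 2 * ε) * y' - (1 + ε) * x') ≤
        V x t - V y t - ((1 + 2 * ε) * y - (1 + ε) * x) := fun x' y' hx' hxy' hy' =>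
    le_of_mul_le_mul_left (hmax (hmemS x' y' t ht hx' hxy' hy')) hweight
  have hxγ' : γ t < x := by
    refine lt_of_le_of_ne hxγ fun hγx => ?_
    -- On the boundary, raising `x` alone changes the penalized difference at rate `d + (1 + ε) ≥ ε
    -- > 0`, contradicting maximality.
    obtain ⟨d, hd, hder⟩ := hslope t ⟨htτ, htT⟩
    rw [hγx] at hder
    have hder' : HasDerivWithinAt (fun z => V z t + (1 + ε) * z) (d + (1 + ε)) (Ici x) x := by
      have : HasDerivWithinAt (fun z : ℝ => (1 + ε) * z) (1 + ε) (Ici x) x := by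
        simpa using (hasDerivWithinAt_id x (Ici x)).const_mul (1 + ε)
      exact hder.add this
    have hlim := (hasDerivWithinAt_iff_tendsto_slope' (by simp)).1
      (hder'.mono Ioi_subset_Ici_self)
    have hle : d + (1 + ε) ≤ 0 := by
      refine le_of_tendsto hlim ?_
      filter_upwards [Ioo_mem_nhdsGT hxy'] with z hz
      rw [slope_def_field]
      refine div_nonpos_of_nonpos_of_nonneg ?_ (sub_pos.2 hz.1).le
      have := hcmp z y (hxγ.trans hz.1.le) hz.2.le hyR'.le
      linarith
    linarith
  have hxpos : 0 < x := (hγ0 t (hsubI ht)).trans_lt hxγ'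
  have htpos : 0 < t := hτ.trans_lt htτ
  refine h.no_interior_max h (c := (1 + 2 * ε) * y - (1 + ε) * x) hxpos (hxpos.trans hxy')
    ⟨htpos, htT⟩ htτ hW ?_ ?_
  · have hcont : ∀ z : ℝ, Tendsto (fun l : ℝ => l * z) (𝓝 1) (𝓝 z) := fun z => by
      have : Continuous fun l : ℝ => l * z := by fun_prop
      simpa using this.tendsto 1
    filter_upwards [(hcont x).eventually (lt_mem_nhds hxγ'),
      (hcont y).eventually (gt_mem_nhds hyR'), lt_mem_nhds (show (0 : ℝ) < 1 by norm_num)]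
      with l h1 h2 h3
    have := hcmp (l * x) (l * y) h1.le (mul_le_mul_of_nonneg_left hxy h3.le) h2.le
    simp only [one_mul] at this ⊢
    linarith
  · have hγt := (hγ.continuousAt (Icc_mem_nhds htpos htT)).eventually (gt_mem_nhds hxγ')
    filter_upwards [hγt, Ioo_mem_nhds htτ htT] with s hs hs'
    exact hmax (hmemS x y s ⟨hs'.1.le, hs'.2.le⟩ hs.le hxy hyR'.le)

end IsBlackScholesSolution

/-! ### Comparison of policies -/

namespace IsExtendedSolution

variable {r σ K T : ℝ} {b γ : ℝ → ℝ} {V W : ℝ → ℝ → ℝ}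

theorem boundary_terminal (h : IsExtendedSolution r σ K T b V) (hT : 0 ≤ T) : b T = K := by
  have h1 := h.boundary T ⟨hT, le_rfl⟩
  have h2 := h.terminal (b T) le_rfl
  linarith

/-- The continuation value is nonnegative above the exercise boundary. -/
theorem nonneg_above (h : IsExtendedSolution r σ K T b V) (hb : IsExerciseBoundary K T b)
    {t x : ℝ} (ht : t ∈ Icc 0 T) (hx : b t ≤ x) : 0 ≤ V x t :=
  (IsBlackScholesSolution.zero r σ T).le_of_boundary h.solution hb.continuousOn hb.nonneg
    (fun t ht => by rw [h.boundary t ht]; linarith [hb.le_strike t ht])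
    (fun x hx => (h.terminal x hx).ge) ht hx

theorem le_of_le_payoff (hV : IsExtendedSolution r σ K T b V)
    (hγ : IsExerciseBoundary K T γ) (hW : IsExtendedSolution r σ K T γ W)
    (hle : ∀ t ∈ Icc 0 T, V (γ t) t ≤ payoff K (γ t)) {t x : ℝ} (ht : t ∈ Icc 0 T)
    (hx : γ t ≤ x) : V x t ≤ W x t := by
  refine hV.solution.le_of_boundary hW.solution hγ.continuousOn hγ.nonneg (fun t ht => ?_)
    (fun x hx => ?_) ht hx
  · have := hle t ht
    rwa [payoff, max_eq_left (sub_nonneg.2 (hγ.le_strike t ht)), ← hW.boundary t ht] at this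
  · have hT := ht.1.trans ht.2
    rw [hW.terminal x hx, hV.terminal x]
    rwa [hV.boundary_terminal hT, ← hW.boundary_terminal hT]

/-- The chord bound from the boundary value `K - γ(s)` gives the claim at later times `s`, and
continuity carries it back to `t`, which may be `0`. -/
theorem strike_sub_le (hγ : IsExerciseBoundary K T γ) (hW : IsExtendedSolution r σ K T γ W)
    {t x : ℝ} (ht : t ∈ Ico 0 T) (hslope : ∀ s ∈ Ioo 0 T, t ≤ s → ∃ d : ℝ, -1 ≤ d ∧
      HasDerivWithinAt (fun x => W x s) d (Ici (γ s)) (γ s)) (hx : γ t < x) :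
    K - x ≤ W x t := by
  have hx0 : 0 ≤ x := (hγ.nonneg t ⟨ht.1, ht.2.le⟩).trans hx.le
  have := (IsBlackScholesSolution.zero r σ T).le_of_forall_later hW.solution hγ.continuousOn
    (c := x - K) ht hx hx0 fun s hs hs' => by
      have := hW.solution.sub_le_of_slope_of_mem_Ioo hγ.continuousOn hγ.nonneg hW.terminal ht.1
        (fun u hu => hslope u ⟨ht.1.trans_lt hu.1, hu.2⟩ hu.1.le) hs hs'
      rw [hW.boundary s ⟨ht.1.trans hs.1.le, hs.2.le⟩] at this
      linarith
  linarith

theorem replicationValue_le (hb : IsExerciseBoundary K T b)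
    (hV : IsExtendedSolution r σ K T b V) (hγ : IsExerciseBoundary K T γ)
    (hW : IsExtendedSolution r σ K T γ W)
    (hle : ∀ t ∈ Icc 0 T, V (γ t) t ≤ payoff K (γ t))
    (hbetter : ExerciseBetterBetween K T b γ V) (hslope : SlopeConditionWhereLowered T b γ W)
    {t : ℝ} (ht : t ∈ Icc 0 T) (x : ℝ) :
    replicationValue K b V x t ≤ replicationValue K γ W x t := by
  unfold replicationValue
  split_ifs with h1 h2 h2
  · exact hV.le_of_le_payoff hγ hW hle ht h2.le
  · exact hbetter t ht x (mem_uIcc.2 (Or.inl ⟨h1.le, not_lt.1 h2⟩))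
  -- The old policy exercises and the new one waits: the only case that uses the slope condition.
  · have hxb := not_lt.1 h1
    have hlow : γ t < b t := h2.trans_le hxb
    have htT : t < T := by
      refine lt_of_le_of_ne ht.2 fun h => ?_
      subst h
      exact hlow.ne (by rw [hV.boundary_terminal ht.1, hW.boundary_terminal ht.1])
    rw [payoff, max_eq_left (sub_nonneg.2 (hxb.trans (hb.le_strike t ht)))]
    exact strike_sub_le hγ hW ⟨ht.1, htT⟩ (hslope t ht hlow) h2
  · exact le_rfl

end IsExtendedSolution

/-! ### Continuous selection of the new boundary -/

/-- A locally satisfiable size condition `P`, inherited by smaller sizes, has a continuous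
nonnegative selection that is positive exactly where the condition is locally satisfiable. -/
theorem exists_continuous_size_selection (P : ℝ → ℝ → Prop)
    (hP : ∀ t δ δ', 0 < δ' → δ' ≤ δ → P t δ → P t δ') :
    ∃ h : ℝ → ℝ, Continuous h ∧ (∀ t, 0 ≤ h t) ∧ (∀ t, 0 < h t → P t (h t)) ∧
      ∀ t, (∃ δ > 0, ∀ᶠ s in 𝓝 t, P s δ) → 0 < h t := by
  set S : ℝ → Set ℝ := fun t => {δ | δ ∈ Ioc 0 1 ∧ P t δ} with hS
  set m : ℝ → ℝ := fun t => sSup (S t) with hm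
  have hSb : ∀ t, BddAbove (S t) := fun t => ⟨1, fun δ hδ => hδ.1.2⟩
  have hm0 : ∀ t, 0 ≤ m t := fun t => Real.sSup_nonneg fun δ hδ => hδ.1.1.le
  have hbdd : ∀ t, BddBelow (range fun s => m s / 2 + |t - s|) := fun t =>
    ⟨0, by rintro _ ⟨s, rfl⟩; have := hm0 s; positivity⟩
  -- The infimum is 1-Lipschitz in `t`. Halving `m` keeps it strictly below the supremum, which need
  -- not be attained.
  refine ⟨fun t => ⨅ s, (m s / 2 + |t - s|), ?_, fun t => ?_, fun t ht => ?_, fun t ht => ?_⟩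
  · refine (LipschitzWith.of_le_add fun x y => ?_).continuous
    rw [← sub_le_iff_le_add]
    refine le_ciInf fun s => ?_
    have h1 := ciInf_le (hbdd x) s
    have h2 := abs_sub_le x y s
    rw [Real.dist_eq]
    linarith
  · exact Real.iInf_nonneg fun s => by have := hm0 s; positivity
  · have hle : (⨅ s, (m s / 2 + |t - s|)) ≤ m t / 2 := by simpa using ciInf_le (hbdd t) t
    have hlt : (⨅ s, (m s / 2 + |t - s|)) < m t := by linarith
    have hne : (S t).Nonempty := by
      by_contra hempty
      have : m t = 0 := by rw [hm]; simp [not_nonempty_iff_eq_empty.1 hempty]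
      linarith
    obtain ⟨δ, hδ, hδ'⟩ := exists_lt_of_lt_csSup hne hlt
    exact hP t δ _ ht hδ'.le hδ.2
  · obtain ⟨δ, hδ, hev⟩ := ht
    obtain ⟨ε, hε, hball⟩ := Metric.eventually_nhds_iff.1 hev
    refine lt_of_lt_of_le (lt_min (half_pos (lt_min hδ one_pos)) hε) (le_ciInf fun s => ?_)
    rcases lt_or_ge |t - s| ε with hs | hs
    · have hmem : min δ 1 ∈ S s :=
        ⟨⟨lt_min hδ one_pos, min_le_right _ _⟩, hP s δ _ (lt_min hδ one_pos) (min_le_left _ _)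
          (hball (by rwa [dist_comm, Real.dist_eq]))⟩
      have : min δ 1 ≤ m s := le_csSup (hSb s) hmem
      have := min_le_left (min δ 1 / 2) ε
      have := abs_nonneg (t - s)
      linarith
    · have := min_le_right (min δ 1 / 2) ε
      have := hm0 s
      linarith

theorem sub_le_payoff (K x : ℝ) : K - x ≤ payoff K x := le_max_left _ _

namespace IsBlackScholesSolution

variable {r σ T : ℝ} {V : ℝ → ℝ → ℝ}

theorem hasDerivAt_add_id (h : IsBlackScholesSolution r σ T V) {x t : ℝ} (hx : 0 < x)
    (ht : t ∈ Ioo 0 T) : HasDerivAt (fun y => V y t + y) (partialX V x t + 1) x :=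
  (h.differentiable_x x hx t ht).hasDerivAt.add (hasDerivAt_id x)

theorem strictMonoOn_add_id (h : IsBlackScholesSolution r σ T V) {D : Set ℝ} (hD : Convex ℝ D)
    {t : ℝ} (ht : t ∈ Ioo 0 T) (hD0 : ∀ x ∈ D, 0 < x) (hs : ∀ x ∈ D, -1 < partialX V x t) :
    StrictMonoOn (fun y => V y t + y) D := by
  refine strictMonoOn_of_deriv_pos hD
    (fun x hx => (h.hasDerivAt_add_id (hD0 x hx) ht).continuousAt.continuousWithinAt)
    fun x hx => ?_
  have hx := interior_subset hx
  rw [(h.hasDerivAt_add_id (hD0 x hx) ht).deriv]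
  linarith [hs x hx]

theorem strictAntiOn_add_id (h : IsBlackScholesSolution r σ T V) {D : Set ℝ} (hD : Convex ℝ D)
    {t : ℝ} (ht : t ∈ Ioo 0 T) (hD0 : ∀ x ∈ D, 0 < x) (hs : ∀ x ∈ D, partialX V x t < -1) :
    StrictAntiOn (fun y => V y t + y) D := by
  refine strictAntiOn_of_deriv_neg hD
    (fun x hx => (h.hasDerivAt_add_id (hD0 x hx) ht).continuousAt.continuousWithinAt)
    fun x hx => ?_
  have hx := interior_subset hx
  rw [(h.hasDerivAt_add_id (hD0 x hx) ht).deriv]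
  linarith [hs x hx]

/-- A condition on the slope that is open holds on a product neighbourhood. -/
theorem exists_box_partialX_mem (h : IsBlackScholesSolution r σ T V) {U : Set ℝ} (hU : IsOpen U)
    {x t : ℝ} (hx : 0 < x) (ht : t ∈ Ioo 0 T) (hmem : partialX V x t ∈ U) :
    ∃ ε > 0, ∀ᶠ s in 𝓝 t, s ∈ Ioo 0 T ∧
      ∀ y ∈ Ioo (x - ε) (x + ε), 0 < y ∧ partialX V y s ∈ U := by
  have hopen : Ioi 0 ×ˢ Ioo 0 T ∈ 𝓝 (x, t) :=
    (isOpen_Ioi.prod isOpen_Ioo).mem_nhds ⟨hx, ht⟩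
  have hc := (h.continuousOn_x.continuousAt hopen).eventually (hU.mem_nhds hmem)
  rw [nhds_prod_eq] at hopen hc
  obtain ⟨A, hA, B, hB, hAB⟩ := mem_prod_iff.1 (inter_mem hopen hc)
  obtain ⟨ε, hε, hball⟩ := Metric.mem_nhds_iff.1 hA
  rw [Real.ball_eq_Ioo] at hball
  refine ⟨ε, hε, ?_⟩
  filter_upwards [hB, Ioo_mem_nhds ht.1 ht.2] with s hs hs'
  refine ⟨hs', fun y hy => ?_⟩
  have := hAB (mk_mem_prod (hball hy) hs)
  exact ⟨this.1.1, this.2⟩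

end IsBlackScholesSolution

namespace IsExtendedSolution

variable {r σ K T : ℝ} {b : ℝ → ℝ} {V : ℝ → ℝ → ℝ}

/-- If `b(t) = K`, then `V` vanishes at `b(t)` and a slope below `-1` would make it negative just
above. -/
theorem boundary_lt_strike (h : IsExtendedSolution r σ K T b V) (hb : IsExerciseBoundary K T b)
    {t : ℝ} (ht : t ∈ Ioo 0 T) (hbt : 0 < b t) (hs : partialX V (b t) t < -1) : b t < K := by
  have ht' := Ioo_subset_Icc_self ht
  refine lt_of_le_of_ne (hb.le_strike t ht') fun hK => ?_
  obtain ⟨ε, hε, hev⟩ := h.solution.exists_box_partialX_mem isOpen_Iio hbt ht hs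
  have hbox := hev.self_of_nhds.2
  have hanti := h.solution.strictAntiOn_add_id (convex_Ioo _ _) ht (fun y hy => (hbox y hy).1)
    fun y hy => (hbox y hy).2
  have h1 := hanti (a := b t) (b := b t + ε / 2) ⟨by linarith, by linarith⟩
    ⟨by linarith, by linarith⟩ (by linarith)
  have h2 := h.nonneg_above hb ht' (x := b t + ε / 2) (by linarith)
  simp only [h.boundary t ht'] at h1
  linarith

/-- Where the slope exceeds `-1`, the boundary can locally be lowered by a uniform amount. -/
theorem eventually_lt_payoff_below (h : IsExtendedSolution r σ K T b V)
    (hb : IsExerciseBoundary K T b) {t : ℝ} (ht : t ∈ Ioo 0 T) (hbt : 0 < b t)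
    (hs : -1 < partialX V (b t) t) :
    ∃ δ > 0, ∀ᶠ s in 𝓝 t, s ∈ Ioo 0 T ∧ 0 < b s ∧ -1 < partialX V (b s) s ∧ δ ≤ b s ∧
      ∀ x ∈ Ico (b s - δ) (b s), V x s < payoff K x := by
  obtain ⟨ε, hε, hev⟩ := h.solution.exists_box_partialX_mem isOpen_Ioi hbt ht hs
  have hbc := hb.continuousOn.continuousAt (Icc_mem_nhds ht.1 ht.2)
  refine ⟨min (ε / 2) (b t / 2), by positivity, ?_⟩
  have hδ₁ := min_le_left (ε / 2) (b t / 2)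
  have hδ₂ := min_le_right (ε / 2) (b t / 2)
  filter_upwards [hev, hbc.eventually (Ioo_mem_nhds
    (max_lt (show b t - ε / 2 < b t by linarith) (show b t / 2 < b t by linarith))
    (show b t < b t + ε / 2 by linarith))] with s ⟨hsI, hbox⟩ ⟨hs1, hs2⟩
  obtain ⟨hs1, hs3⟩ := max_lt_iff.1 hs1
  have hmem : b s ∈ Ioo (b t - ε) (b t + ε) := ⟨by linarith, by linarith⟩
  refine ⟨hsI, (hbox _ hmem).1, (hbox _ hmem).2, by linarith, fun x hx => ?_⟩
  have hmono := h.solution.strictMonoOn_add_id (convex_Ioo _ _) hsI (fun y hy => (hbox y hy).1)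
    fun y hy => (hbox y hy).2
  have h1 := hmono (a := x) (b := b s) ⟨by linarith [hx.1], by linarith [hx.2]⟩ hmem hx.2
  simp only [h.boundary s (Ioo_subset_Icc_self hsI)] at h1
  linarith [sub_le_payoff K x]

/-- Where the slope is less than `-1`, the boundary can locally be raised by a uniform amount. -/
theorem eventually_lt_payoff_above (h : IsExtendedSolution r σ K T b V)
    (hb : IsExerciseBoundary K T b) {t : ℝ} (ht : t ∈ Ioo 0 T) (hbt : 0 < b t)
    (hs : partialX V (b t) t < -1) :
    ∃ δ > 0, ∀ᶠ s in 𝓝 t, s ∈ Ioo 0 T ∧ 0 < b s ∧ partialX V (b s) s < -1 ∧ b s + δ ≤ K ∧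
      ∀ x ∈ Ioc (b s) (b s + δ), V x s < payoff K x := by
  have hK := sub_pos.2 (h.boundary_lt_strike hb ht hbt hs)
  obtain ⟨ε, hε, hev⟩ := h.solution.exists_box_partialX_mem isOpen_Iio hbt ht hs
  have hbc := hb.continuousOn.continuousAt (Icc_mem_nhds ht.1 ht.2)
  refine ⟨min (ε / 2) ((K - b t) / 2), by positivity, ?_⟩
  have hδ₁ := min_le_left (ε / 2) ((K - b t) / 2)
  have hδ₂ := min_le_right (ε / 2) ((K - b t) / 2)
  filter_upwards [hev, hbc.eventually (Ioo_mem_nhds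
    (show b t - ε / 2 < b t by linarith) (lt_min (show b t < b t + ε / 2 by linarith)
      (show b t < b t + (K - b t) / 2 by linarith)))] with s ⟨hsI, hbox⟩ ⟨hs1, hs2⟩
  obtain ⟨hs2, hs3⟩ := lt_min_iff.1 hs2
  have hmem : b s ∈ Ioo (b t - ε) (b t + ε) := ⟨by linarith, by linarith⟩
  refine ⟨hsI, (hbox _ hmem).1, (hbox _ hmem).2, by linarith, fun x hx => ?_⟩
  have hanti := h.solution.strictAntiOn_add_id (convex_Ioo _ _) hsI (fun y hy => (hbox y hy).1)
    fun y hy => (hbox y hy).2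
  have h1 := hanti (a := b s) (b := x) hmem ⟨by linarith [hx.1], by linarith [hx.2]⟩ hx.1
  simp only [h.boundary s (Ioo_subset_Icc_self hsI)] at h1
  linarith [sub_le_payoff K x]

theorem exists_improvingSelection (h : IsExtendedSolution r σ K T b V)
    (hb : IsExerciseBoundary K T b) (hT : 0 ≤ T) :
    ∃ γ : ℝ → ℝ, IsExerciseBoundary K T γ ∧ γ T = K ∧ IsImprovingSelection K T b γ V := by
  -- The size conditions include `s ∈ Ioo 0 T` and the slope inequality, so that `f` and `g` vanish
  -- at `T` and under smooth pasting, and are never both positive.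
  obtain ⟨f, hfc, hf0, hfP, hfpos⟩ := exists_continuous_size_selection
    (fun s δ => s ∈ Ioo 0 T ∧ 0 < b s ∧ -1 < partialX V (b s) s ∧ δ ≤ b s ∧
      ∀ x ∈ Ico (b s - δ) (b s), V x s < payoff K x)
    fun s δ δ' _ hle ⟨h1, h2, h3, h4, h5⟩ => ⟨h1, h2, h3, hle.trans h4,
      fun x hx => h5 x ⟨by linarith [hx.1], hx.2⟩⟩
  obtain ⟨g, hgc, hg0, hgP, hgpos⟩ := exists_continuous_size_selection
    (fun s δ => s ∈ Ioo 0 T ∧ 0 < b s ∧ partialX V (b s) s < -1 ∧ b s + δ ≤ K ∧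
      ∀ x ∈ Ioc (b s) (b s + δ), V x s < payoff K x)
    fun s δ δ' _ hle ⟨h1, h2, h3, h4, h5⟩ => ⟨h1, h2, h3, by linarith,
      fun x hx => h5 x ⟨hx.1, by linarith [hx.2]⟩⟩
  have hcases : ∀ t, (f t = 0 ∧ g t = 0) ∨ (0 < f t ∧ g t = 0) ∨ (f t = 0 ∧ 0 < g t) := by
    intro t
    rcases (hf0 t).eq_or_lt with hf | hf <;> rcases (hg0 t).eq_or_lt with hg | hg
    · exact Or.inl ⟨hf.symm, hg.symm⟩
    · exact Or.inr (Or.inr ⟨hf.symm, hg⟩)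
    · exact Or.inr (Or.inl ⟨hf, hg.symm⟩)
    · exact absurd (hfP t hf).2.2.1 (hgP t hg).2.2.1.not_gt
  refine ⟨fun t => b t - f t + g t, ⟨?_, fun t ht => ?_, fun t ht => ?_⟩, ?_,
    ⟨fun t ht hbt hs => ?_, fun t ht hbt hs => ?_, fun t ht hbt hs => ?_, fun t ht x hx hne => ?_⟩⟩
  · exact (hb.continuousOn.sub hfc.continuousOn).add hgc.continuousOn
  · have := hb.nonneg t ht
    rcases hcases t with ⟨h1, h2⟩ | ⟨h1, h2⟩ | ⟨h1, h2⟩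
    · linarith
    · linarith [(hfP t h1).2.2.2.1]
    · linarith
  · have := hb.le_strike t ht
    rcases hcases t with ⟨h1, h2⟩ | ⟨h1, h2⟩ | ⟨h1, h2⟩
    · linarith
    · linarith
    · linarith [(hgP t h2).2.2.2.1]
  · have := h.boundary_terminal hT
    rcases hcases T with ⟨h1, h2⟩ | ⟨h1, h2⟩ | ⟨h1, h2⟩
    · linarith
    · exact absurd (hfP T h1).1.2 (lt_irrefl T)
    · exact absurd (hgP T h2).1.2 (lt_irrefl T)
  · have hg := hgpos t (h.eventually_lt_payoff_above hb ht hbt hs)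
    rcases hcases t with ⟨h1, h2⟩ | ⟨h1, h2⟩ | ⟨h1, h2⟩ <;> linarith
  · have hf := hfpos t (h.eventually_lt_payoff_below hb ht hbt hs)
    rcases hcases t with ⟨h1, h2⟩ | ⟨h1, h2⟩ | ⟨h1, h2⟩ <;> linarith
  · rcases hcases t with ⟨h1, h2⟩ | ⟨h1, h2⟩ | ⟨h1, h2⟩
    · linarith
    · linarith [(hfP t h1).2.2.1]
    · linarith [(hgP t h2).2.2.1]
  · rcases hcases t with ⟨h1, h2⟩ | ⟨h1, h2⟩ | ⟨h1, h2⟩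
    · simp only [h1, h2, sub_zero, add_zero, uIcc_self, mem_singleton_iff] at hx
      exact absurd hx hne
    · rw [h2, add_zero, uIcc_of_ge (by linarith)] at hx
      exact (hfP t h1).2.2.2.2 x ⟨hx.1, lt_of_le_of_ne hx.2 hne⟩
    · rw [h1, sub_zero, uIcc_of_le (by linarith)] at hx
      exact (hgP t h2).2.2.2.2 x ⟨lt_of_le_of_ne hx.1 hne.symm, hx.2⟩

end IsExtendedSolution

theorem mainTheorem3 (r σ K T : ℝ) (b : ℝ → ℝ) (Vπ : ℝ → ℝ → ℝ)
    (hb : IsExerciseBoundary K T b) (hVπ : IsExtendedSolution r σ K T b Vπ) :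
    -- every policy `q` whose boundary `γ` satisfies the improvement condition
    (∀ (γ : ℝ → ℝ) (Vq : ℝ → ℝ → ℝ), IsExerciseBoundary K T γ →
      (∀ t ∈ Icc 0 T, Vπ (γ t) t ≤ payoff K (γ t)) →
      IsExtendedSolution r σ K T γ Vq →
        -- (i)
        (∀ t ∈ Icc 0 T, ∀ x, γ t ≤ x → Vπ x t ≤ Vq x t) ∧
        -- (ii)
        (ExerciseBetterBetween K T b γ Vπ → SlopeConditionWhereLowered T b γ Vq →
          ∀ t ∈ Icc 0 T, ∀ x, 0 ≤ x →
            replicationValue K b Vπ x t ≤ replicationValue K γ Vq x t)) ∧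
    -- the selection of the new boundary in (ii) is possible
    (∃ γ : ℝ → ℝ, IsExerciseBoundary K T γ ∧ γ T = K ∧ IsImprovingSelection K T b γ Vπ) := by
  refine ⟨fun γ Vq hγ hle hVq => ⟨fun t ht x hx => hVπ.le_of_le_payoff hγ hVq hle ht hx,
    fun hbetter hslope t ht x _ => hVπ.replicationValue_le hb hγ hVq hle hbetter hslope ht x⟩, ?_⟩
  rcases le_or_gt 0 T with hT | hT
  · exact hVπ.exists_improvingSelection hb hT
  -- For `T < 0` all conditions on `γ` are vacuous except `γ T = K`.
  · have hempty : ∀ t, t ∉ Icc 0 T := fun t ht => (ht.1.trans ht.2).not_gt hT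
    have hempty' : ∀ t, t ∉ Ioo 0 T := fun t ht => hempty t (Ioo_subset_Icc_self ht)
    exact ⟨fun _ => K, ⟨continuousOn_const, fun t ht => (hempty t ht).elim, fun _ _ => le_rfl⟩, rfl,
      ⟨fun t ht => (hempty' t ht).elim, fun t ht => (hempty' t ht).elim,
        fun t ht => (hempty' t ht).elim, fun t ht => (hempty t ht).elim⟩⟩
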